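/- Consider the Gaussian linear regression model $y = X\beta + \varepsilon$, where $X$ is an $n\times p$ real matrix, $\beta\in\mathbb{R}^p$, $\varepsilon\sim N(0,\sigma^2 I_n)$ and $\sigma>0$. Let $r=\mathrm{rank}(X)$ and assume that any $r$ columns of $X$ are linearly independent. A model is a subset $M$ of the $p$ predictors; with the diagonal indicator matrix $D_M$ of $M$, its least squares estimate is $\hat\beta_M=(D_MX'XD_M)^{+}D_MX'y$, where $^+$ denotes the Moore-Penrose inverse. Let $\pi$ be a prior on the model size, that is, $\pi(k)>0$ for $k=0,\dots,r$, $\pi(k)=0$ for $k>r$ and $\sum_{k=0}^r\pi(k)=1$. For $\gamma>0$ define the penalty $$\mathrm{Pen}(k)=2\sigma^2(1+1/\gamma)\ln\Big\{\tbinom{p}{k}\pi(k)^{-1}(1+\gamma)^{k/2}\Big\},\quad k=0,\dots,r-1,\qquad \mathrm{Pen}(r)=2\sigma^2(1+1/\gamma)\ln\big\{\pi(r)^{-1}(1+\gamma)^{r/2}\big\},$$ and let the MAP model $\hat M$ be a (measurable) minimizer of $\|y-X\hat\beta_M\|^2+\mathrm{Pen}(|M|)$ over the models $M$ with $|M|\le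 r$. Theorem (oracle inequality). For every $\gamma>0$ and every $c>0$ there is a constant $c_2\ge 1$, depending only on $\gamma$ and $c$, such that the following holds for all $n,p,X,\sigma,\beta,\pi$ as above. Suppose that (P) $\pi(k)\le\binom{p}{k}e^{-c(\gamma)k}$ for $k=0,\dots,r-1$ and $\pi(r)\le e^{-c(\gamma)r}$, where $c(\gamma)=8(\gamma+3/4)^2$, and that $\pi(0)\ge p^{-c}$ and $\pi(k)\ge p^{-ck}$ for $k=1,\dots,r$. Then $\|X\hat\beta_{\hat M}-X\beta\|^2$ is integrable and $$E\|X\hat\beta_{\hat M}-X\beta\|^2\le c_2\,\ln p\,\Big(\inf_M E\|X\hat\beta_M-X\beta\|^2+\sigma^2\Big),$$ where the infimum is over all models $M$. -/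

import Mathlib

open MeasureTheory ProbabilityTheory

namespace MAPSelection

noncomputable section

/-! ### The generalized (Moore-Penrose) inverse -/

/-- `B` is the Moore-Penrose inverse of the real matrix `A`: the four Penrose equations. -/
structure IsMoorePenrose {m n : ℕ} (A : Matrix (Fin m) (Fin n) ℝ)
    (B : Matrix (Fin n) (Fin m) ℝ) : Prop where
  mul_mul_self : A * B * A = A
  mul_mul_inv : B * A * B = B
  symm_left : (A * B).transpose = A * B
  symm_right : (B * A).transpose = B * A

theorem IsMoorePenrose.unique {m n : ℕ} {A : Matrix (Fin m) (Fin n) ℝ}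
    {B C : Matrix (Fin n) (Fin m) ℝ} (hB : IsMoorePenrose A B) (hC : IsMoorePenrose A C) :
    B = C := by
  have h1 : A * B = A * C := by
    calc A * B = (A * C * A) * B := by rw [hC.mul_mul_self]
      _ = (A * C).transpose * (A * B).transpose := by
          rw [hC.symm_left, hB.symm_left, Matrix.mul_assoc (A * C)]
      _ = ((A * B * A) * C).transpose := by
          rw [← Matrix.transpose_mul, Matrix.mul_assoc (A * B)]
      _ = A * C := by rw [hB.mul_mul_self, hC.symm_left]
  have h2 : B * A = C * A := by
    calc B * A = B * (A * C * A) := by rw [hC.mul_mul_self]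
      _ = (B * A).transpose * (C * A).transpose := by
          rw [hC.symm_right, hB.symm_right]; simp only [Matrix.mul_assoc]
      _ = (C * (A * B * A)).transpose := by
          rw [← Matrix.transpose_mul]; simp only [Matrix.mul_assoc]
      _ = C * A := by rw [hB.mul_mul_self, hC.symm_right]
  calc B = B * A * B := hB.mul_mul_inv.symm
    _ = C * (A * B) := by rw [h2, Matrix.mul_assoc]
    _ = C * A * C := by rw [h1, Matrix.mul_assoc]
    _ = C := hC.mul_mul_inv

theorem exists_isMoorePenrose_of_isSymm {n : ℕ} {A : Matrix (Fin n) (Fin n) ℝ}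
    (hA : A.IsSymm) : ∃ B, IsMoorePenrose A B := by
  have hA' : A.IsHermitian := by
    rw [Matrix.IsHermitian, Matrix.conjTranspose_eq_transpose_of_trivial]; exact hA
  obtain ⟨U, hU, d, hd⟩ : ∃ U : Matrix (Fin n) (Fin n) ℝ, U.transpose * U = 1 ∧
      ∃ d : Fin n → ℝ, A = U * Matrix.diagonal d * U.transpose := by
    refine ⟨hA'.eigenvectorUnitary, ?_, hA'.eigenvalues, ?_⟩
    · have := (Matrix.mem_unitaryGroup_iff'.1 hA'.eigenvectorUnitary.2)
      rwa [Matrix.star_eq_conjTranspose,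
        Matrix.conjTranspose_eq_transpose_of_trivial] at this
    · conv_lhs => rw [hA'.spectral_theorem]
      rw [Unitary.conjStarAlgAut_apply, Matrix.star_eq_conjTranspose,
        Matrix.conjTranspose_eq_transpose_of_trivial]
      rfl
  have key : ∀ a b : Fin n → ℝ, (U * Matrix.diagonal a * U.transpose) *
      (U * Matrix.diagonal b * U.transpose) =
      U * Matrix.diagonal (fun i => a i * b i) * U.transpose := by
    intro a b
    calc _ = U * Matrix.diagonal a * (U.transpose * U) * Matrix.diagonal b * U.transpose := by
          simp only [Matrix.mul_assoc]
      _ = _ := by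
          rw [hU, Matrix.mul_one, Matrix.mul_assoc U, Matrix.diagonal_mul_diagonal]
  have ktr : ∀ a : Fin n → ℝ, (U * Matrix.diagonal a * U.transpose).transpose =
      U * Matrix.diagonal a * U.transpose := by
    intro a
    simp [Matrix.transpose_mul, Matrix.mul_assoc]
  refine ⟨U * Matrix.diagonal (fun i => (d i)⁻¹) * U.transpose, ?_, ?_, ?_, ?_⟩
  · rw [hd, key, key]; simp only [mul_inv_mul_cancel]
  · rw [hd, key, key]
    have : ∀ i, (d i)⁻¹ * d i * (d i)⁻¹ = (d i)⁻¹ := fun i => by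
      by_cases h : d i = 0
      · simp [h]
      · field_simp
    simp only [this]
  · rw [hd, key, ktr]
  · rw [hd, key, ktr]

open Classical in
/-- The generalized inverse `A⁺`. -/
def pinv {n : ℕ} (A : Matrix (Fin n) (Fin n) ℝ) : Matrix (Fin n) (Fin n) ℝ :=
  if h : ∃ B, IsMoorePenrose A B then h.choose else 0

theorem isMoorePenrose_pinv {n : ℕ} {A : Matrix (Fin n) (Fin n) ℝ} (hA : A.IsSymm) :
    IsMoorePenrose A (pinv A) := by
  rw [pinv, dif_pos (exists_isMoorePenrose_of_isSymm hA)]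
  exact (exists_isMoorePenrose_of_isSymm hA).choose_spec

/-! ### Models and least squares estimates -/

/-- The diagonal indicator matrix `D_M` of a model `M`, a set of predictors. -/
def indicatorMatrix {p : ℕ} (M : Finset (Fin p)) : Matrix (Fin p) (Fin p) ℝ :=
  Matrix.diagonal (fun j => if j ∈ M then 1 else 0)

/-- The least squares estimate `(D_M X' X D_M)⁺ D_M X' y` of the coefficients in the model `M`. -/
def lse {n p : ℕ} (X : Matrix (Fin n) (Fin p) ℝ) (M : Finset (Fin p))
    (y : EuclideanSpace ℝ (Fin n)) : EuclideanSpace ℝ (Fin p) :=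
  (pinv (indicatorMatrix M * X.transpose * X * indicatorMatrix M) *
    indicatorMatrix M * X.transpose).toEuclideanLin y

/-- The squared error `‖X β̂_M - X β‖²` of the model `M` with data `y`. -/
def loss {n p : ℕ} (X : Matrix (Fin n) (Fin p) ℝ) (β : EuclideanSpace ℝ (Fin p))
    (M : Finset (Fin p)) (y : EuclideanSpace ℝ (Fin n)) : ℝ :=
  ‖X.toEuclideanLin (lse X M y) - X.toEuclideanLin β‖ ^ 2

/-- Any `r = rank X` columns of `X` are linearly independent. -/
def ColumnsInGeneralPosition {n p : ℕ} (X : Matrix (Fin n) (Fin p) ℝ) : Prop :=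
  ∀ M : Finset (Fin p), M.card = X.rank → LinearIndependent ℝ (fun j : M => X.col j)

/-! ### The prior on the model size, and the MAP criterion -/

/-- `π` is a probability distribution on the model sizes, with support exactly `{0, …, r}`. -/
structure IsSizePrior (r : ℕ) (π : ℕ → ℝ) : Prop where
  pos : ∀ k ≤ r, 0 < π k
  eq_zero : ∀ k, r < k → π k = 0
  sum_eq_one : ∑ k ∈ Finset.range (r + 1), π k = 1

/-- The number of distinguishable models of size `k ≤ r`: all models of size `r` are
identified with the single saturated model. -/
def modelCount (p r k : ℕ) : ℝ := if k < r then (p.choose k : ℝ) else 1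

/-- The complexity penalty `Pen(k)`, `0 ≤ k ≤ r`, of the prior `π`. -/
def penalty (p r : ℕ) (σ γ : ℝ) (π : ℕ → ℝ) (k : ℕ) : ℝ :=
  2 * σ ^ 2 * (1 + 1 / γ) *
    Real.log (modelCount p r k * (π k)⁻¹ * (1 + γ) ^ ((k : ℝ) / 2))

/-- The penalized least squares criterion `‖y - X β̂_M‖² + Pen(|M|)`. -/
def criterion {n p : ℕ} (X : Matrix (Fin n) (Fin p) ℝ) (σ γ : ℝ) (π : ℕ → ℝ)
    (y : EuclideanSpace ℝ (Fin n)) (M : Finset (Fin p)) : ℝ :=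
  ‖y - X.toEuclideanLin (lse X M y)‖ ^ 2 + penalty p X.rank σ γ π M.card

/-- `M` is a maximum a posteriori model for the data `y`. Only models with at most `rank X`
predictors compete, since larger ones have prior probability zero. -/
def IsMAPModel {n p : ℕ} (X : Matrix (Fin n) (Fin p) ℝ) (σ γ : ℝ) (π : ℕ → ℝ)
    (y : EuclideanSpace ℝ (Fin n)) (M : Finset (Fin p)) : Prop :=
  M.card ≤ X.rank ∧
    ∀ M' : Finset (Fin p), M'.card ≤ X.rank →
      criterion X σ γ π y M ≤ criterion X σ γ π y M'

/-- The constant `c(γ) = 8 (γ + 3/4)²`. -/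
def cGamma (γ : ℝ) : ℝ := 8 * (γ + 3 / 4) ^ 2

/-- Assumption (P) on the prior. -/
def AssumptionP (p r : ℕ) (γ : ℝ) (π : ℕ → ℝ) : Prop :=
  (∀ k < r, π k ≤ (p.choose k : ℝ) * Real.exp (-(cGamma γ * k))) ∧
    π r ≤ Real.exp (-(cGamma γ * r))

end

end MAPSelection

namespace MAPSelection

/-! ### Chi-square moments of projected Gaussian noise. -/

section Gaussian

open scoped RealInnerProductSpace

/-! Write `μ = Xβ` and let `W` be the column space of the selected model. Fitted values are
orthogonal projections of `y = μ + ε` (`toEuclideanLin_lse`), so the criterion is a penalized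
projection problem. Comparing the selected model with a fixed competitor and expanding the squares
leaves the competitor's bias and penalty, a centred linear noise term, and the cross term of `ε`
with the selected error minus the selected penalty. That error lies in `W + span μ`, so weighted
AM-GM absorbs a fraction `a < 1` of the loss and leaves `a⁻¹‖proj ε‖² - Pen`
(`one_sub_mul_norm_sq_le_of_penalized_le`). The random choice of `W` is handled by `x ≤ κ exp (x /
κ)` and a sum over all distinguishable models. The chi-square Laplace transform makes each
expectation at most a constant multiple of `σ²` times the prior weight of the model
(`exp_neg_mul_log_mul_inv_sqrt_pow_le`), and the weights sum to one (`sum_modelWeight`). This gives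
`integral_loss_map_le`. Under the lower bounds on the prior, the penalty is of order `σ² (k + 1) log
p` (`penalty_le_log`), while the competitor's risk is bias plus `σ² k`, so the penalty costs only a
factor `log p` and an additional `σ²`. -/

theorem norm_sum_smul_orthonormalBasis_sq {E ι : Type*} [NormedAddCommGroup E] [InnerProductSpace ℝ E]
    [Fintype ι] (b : OrthonormalBasis ι ℝ E)
    (x : ι → ℝ) : ‖∑ i, x i • b i‖ ^ 2 = ∑ i, x i ^ 2 := by
  rw [← b.sum_sq_inner_right]
  refine Finset.sum_congr rfl fun i _ => ?_
  rw [b.orthonormal.inner_right_fintype]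

theorem exp_mul_norm_sum_smul_sq {E ι : Type*} [NormedAddCommGroup E] [InnerProductSpace ℝ E]
    [Fintype ι] (b : OrthonormalBasis ι ℝ E) (t : ℝ)
    (x : ι → ℝ) : Real.exp (t * ‖∑ i, x i • b i‖ ^ 2) = ∏ i, Real.exp (t * x i ^ 2) := by
  rw [norm_sum_smul_orthonormalBasis_sq, Finset.mul_sum, Real.exp_sum]

variable {E : Type*} [NormedAddCommGroup E] [InnerProductSpace ℝ E] [FiniteDimensional ℝ E]
  [MeasurableSpace E] [BorelSpace E]

/-- The characteristic function depends only on the norm, and for `t ∈ V` pairing with the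
projection is pairing in `E`. Projected noise thus has a chi-square squared norm with `finrank V`
degrees of freedom. -/
theorem stdGaussian_map_orthogonalProjectionOnto (V : Submodule ℝ E) :
    (stdGaussian E).map V.orthogonalProjectionOnto = stdGaussian V := by
  have hm : Measurable V.orthogonalProjectionOnto := V.orthogonalProjectionOnto.continuous.measurable
  have : IsProbabilityMeasure ((stdGaussian E).map V.orthogonalProjectionOnto) :=
    Measure.isProbabilityMeasure_map hm.aemeasurable
  apply Measure.ext_of_charFun
  ext t
  have h : charFun ((stdGaussian E).map V.orthogonalProjectionOnto) t =
      charFun (stdGaussian E) (t : E) := by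
    rw [charFun_apply, charFun_apply, integral_map hm.aemeasurable
      (Measurable.aestronglyMeasurable (by fun_prop))]
    simp
  rw [h, charFun_stdGaussian, charFun_stdGaussian]
  simp

theorem integrable_norm_sq_stdGaussian : Integrable (fun x : E => ‖x‖ ^ 2) (stdGaussian E) := by
  have := (IsGaussian.memLp_two_id (μ := stdGaussian E)).integrable_norm_pow (by norm_num)
  simpa using this

theorem integral_norm_sq_stdGaussian :
    ∫ x, ‖x‖ ^ 2 ∂(stdGaussian E) = Module.finrank ℝ E := by
  have hsq : Integrable (fun x : ℝ => x ^ 2) (gaussianReal 0 1) := by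
    have := (IsGaussian.memLp_two_id (μ := gaussianReal 0 1)).integrable_sq
    simpa using this
  have hone : ∫ x, x ^ 2 ∂(gaussianReal 0 1) = 1 := by
    have h := variance_id_gaussianReal (μ := 0) (v := 1)
    rw [variance_of_integral_eq_zero (by fun_prop) (by simp)] at h
    simpa using h
  rw [stdGaussian, integral_map (Measurable.aemeasurable (by fun_prop)) (by fun_prop)]
  simp_rw [norm_sum_smul_orthonormalBasis_sq]
  rw [integral_finsetSum]
  · have : ∀ i : Fin (Module.finrank ℝ E), ∫ x : Fin (Module.finrank ℝ E) → ℝ, x i ^ 2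
        ∂(Measure.pi fun _ => gaussianReal 0 1) = 1 := fun i => by
      rw [integral_comp_eval (μ := fun _ => gaussianReal 0 1) (i := i) (f := fun x : ℝ => x ^ 2)
        (by fun_prop), hone]
    simp [this]
  · intro i _
    exact integrable_comp_eval (μ := fun _ => gaussianReal 0 1) (i := i) hsq

theorem integrable_exp_mul_sq_gaussianReal {t : ℝ} (ht : t < 1 / 2) :
    Integrable (fun x => Real.exp (t * x ^ 2)) (gaussianReal 0 1) := by
  rw [gaussianReal_of_var_ne_zero _ one_ne_zero,
    integrable_withDensity_iff_integrable_smul₀' (by fun_prop)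
      (by simp [gaussianPDF])]
  have := (integrable_exp_neg_mul_sq (b := 1 / 2 - t) (by linarith)).const_mul (√(2 * Real.pi))⁻¹
  refine this.congr (Filter.Eventually.of_forall fun x => ?_)
  simp only [toReal_gaussianPDF, gaussianPDFReal, NNReal.coe_one, mul_one, sub_zero, smul_eq_mul]
  rw [mul_assoc, ← Real.exp_add]
  congr 2
  ring

theorem integral_exp_mul_sq_gaussianReal {t : ℝ} (ht : t < 1 / 2) :
    ∫ x, Real.exp (t * x ^ 2) ∂(gaussianReal 0 1) = (√(1 - 2 * t))⁻¹ := by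
  rw [integral_gaussianReal_eq_integral_smul one_ne_zero]
  have : ∀ x : ℝ, gaussianPDFReal 0 1 x • Real.exp (t * x ^ 2) =
      (√(2 * Real.pi))⁻¹ * Real.exp (-(1 / 2 - t) * x ^ 2) := fun x => by
    simp only [gaussianPDFReal, NNReal.coe_one, mul_one, sub_zero, smul_eq_mul]
    rw [mul_assoc, ← Real.exp_add]
    congr 2
    ring
  simp_rw [this]
  rw [integral_const_mul, integral_gaussian, ← Real.sqrt_inv, ← Real.sqrt_inv,
    ← Real.sqrt_mul (by positivity)]
  congr 1
  have : 1 - 2 * t ≠ 0 := by linarith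
  have : 1 / 2 - t ≠ 0 := by linarith
  field_simp

theorem integrable_exp_mul_norm_sq_stdGaussian {t : ℝ} (ht : t < 1 / 2) :
    Integrable (fun x : E => Real.exp (t * ‖x‖ ^ 2)) (stdGaussian E) := by
  rw [stdGaussian, integrable_map_measure (by fun_prop) (Measurable.aemeasurable (by fun_prop))]
  simp_rw [Function.comp_def, exp_mul_norm_sum_smul_sq]
  exact Integrable.fintype_prod fun _ => integrable_exp_mul_sq_gaussianReal ht

theorem integral_exp_mul_norm_sq_stdGaussian {t : ℝ} (ht : t < 1 / 2) :
    ∫ x, Real.exp (t * ‖x‖ ^ 2) ∂(stdGaussian E) =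
      (√(1 - 2 * t))⁻¹ ^ Module.finrank ℝ E := by
  rw [stdGaussian, integral_map (Measurable.aemeasurable (by fun_prop)) (by fun_prop)]
  simp_rw [exp_mul_norm_sum_smul_sq]
  rw [integral_fintype_prod_eq_prod (f := fun _ x => Real.exp (t * x ^ 2))]
  simp [integral_exp_mul_sq_gaussianReal ht]

variable {Ω : Type*} [MeasurableSpace Ω] {P : Measure Ω} {ξ : Ω → E}

theorem HasLaw.orthogonalProjectionOnto (h : HasLaw ξ (stdGaussian E) P) (V : Submodule ℝ E) :
    HasLaw (fun ω => V.orthogonalProjectionOnto (ξ ω)) (stdGaussian V) P := by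
  have hm : Measurable V.orthogonalProjectionOnto := V.orthogonalProjectionOnto.continuous.measurable
  refine ⟨hm.comp_aemeasurable h.aemeasurable, ?_⟩
  rw [← stdGaussian_map_orthogonalProjectionOnto, ← h.map_eq,
    AEMeasurable.map_map_of_aemeasurable hm.aemeasurable h.aemeasurable]
  rfl

theorem integrable_norm_starProjection_sq (h : HasLaw ξ (stdGaussian E) P) (V : Submodule ℝ E) :
    Integrable (fun ω => ‖V.starProjection (ξ ω)‖ ^ 2) P := by
  have h' := HasLaw.orthogonalProjectionOnto h V
  have := integrable_norm_sq_stdGaussian (E := V)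
  rw [← h'.map_eq] at this
  exact this.comp_aemeasurable h'.aemeasurable

theorem integral_norm_starProjection_sq (h : HasLaw ξ (stdGaussian E) P) (V : Submodule ℝ E) :
    ∫ ω, ‖V.starProjection (ξ ω)‖ ^ 2 ∂P = Module.finrank ℝ V := by
  have h' := HasLaw.orthogonalProjectionOnto h V
  rw [← integral_norm_sq_stdGaussian, ← h'.integral_comp (by fun_prop)]
  rfl

theorem integrable_exp_mul_norm_starProjection_sq (h : HasLaw ξ (stdGaussian E) P)
    (V : Submodule ℝ E) {t : ℝ} (ht : t < 1 / 2) :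
    Integrable (fun ω => Real.exp (t * ‖V.starProjection (ξ ω)‖ ^ 2)) P := by
  have h' := HasLaw.orthogonalProjectionOnto h V
  have := integrable_exp_mul_norm_sq_stdGaussian (E := V) ht
  rw [← h'.map_eq] at this
  exact this.comp_aemeasurable h'.aemeasurable

theorem integral_exp_mul_norm_starProjection_sq (h : HasLaw ξ (stdGaussian E) P)
    (V : Submodule ℝ E) {t : ℝ} (ht : t < 1 / 2) :
    ∫ ω, Real.exp (t * ‖V.starProjection (ξ ω)‖ ^ 2) ∂P =
      (√(1 - 2 * t))⁻¹ ^ Module.finrank ℝ V := by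
  have h' := HasLaw.orthogonalProjectionOnto h V
  rw [← integral_exp_mul_norm_sq_stdGaussian ht, ← h'.integral_comp (by fun_prop)]
  rfl

theorem integrable_of_hasLaw_stdGaussian (h : HasLaw ξ (stdGaussian E) P) : Integrable ξ P := by
  have := IsGaussian.integrable_id (μ := stdGaussian E)
  rw [← h.map_eq] at this
  exact this.comp_aemeasurable h.aemeasurable

theorem integral_inner_eq_zero_of_hasLaw_stdGaussian (h : HasLaw ξ (stdGaussian E) P) (v : E) :
    ∫ ω, ⟪v, ξ ω⟫ ∂P = 0 := by
  rw [integral_inner (integrable_of_hasLaw_stdGaussian h), h.integral_eq]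
  simp

theorem multivariateGaussian_sq_smul_one {n : ℕ} {σ : ℝ} (hσ : 0 ≤ σ) :
    multivariateGaussian 0 (σ ^ 2 • (1 : Matrix (Fin n) (Fin n) ℝ)) =
      (stdGaussian (EuclideanSpace ℝ (Fin n))).map (fun x => σ • x) := by
  open scoped MatrixOrder in
  have hs : CFC.sqrt (σ ^ 2 • (1 : Matrix (Fin n) (Fin n) ℝ)) = σ • 1 := by
    rw [CFC.sqrt_eq_iff _ _ (smul_nonneg (sq_nonneg σ) zero_le_one)
      (smul_nonneg hσ zero_le_one)]
    simp [pow_two, smul_smul]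
  rw [multivariateGaussian, hs]
  congr 1
  ext x
  simp

theorem hasLaw_inv_smul_stdGaussian {n : ℕ} {σ : ℝ} (hσ : 0 < σ)
    {ε : Ω → EuclideanSpace ℝ (Fin n)}
    (h : HasLaw ε (multivariateGaussian 0 (σ ^ 2 • (1 : Matrix (Fin n) (Fin n) ℝ))) P) :
    HasLaw (fun ω => σ⁻¹ • ε ω) (stdGaussian (EuclideanSpace ℝ (Fin n))) P := by
  have hm : AEMeasurable (fun ω => σ⁻¹ • ε ω) P := h.aemeasurable.const_smul σ⁻¹
  refine ⟨hm, ?_⟩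
  have h1 : P.map (fun ω => σ⁻¹ • ε ω) = (P.map ε).map (fun x => σ⁻¹ • x) := by
    rw [AEMeasurable.map_map_of_aemeasurable (by fun_prop) h.aemeasurable]
    rfl
  rw [h1, h.map_eq, multivariateGaussian_sq_smul_one hσ.le,
    Measure.map_map (by fun_prop) (by fun_prop)]
  convert Measure.map_id using 2
  ext x : 1
  simp [smul_smul, hσ.ne']

end Gaussian

end MAPSelection
namespace MAPSelection

/-! ### Least squares as projection; dimensions of column spaces. -/

section LinearAlgebra

open scoped RealInnerProductSpace
open Matrix

variable {n p : ℕ}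

/-- The span of the columns of `X` that belong to the model `M`. -/
noncomputable def colSpan (X : Matrix (Fin n) (Fin p) ℝ) (M : Finset (Fin p)) :
    Submodule ℝ (EuclideanSpace ℝ (Fin n)) :=
  Submodule.span ℝ ((fun j => WithLp.toLp 2 (X.col j)) '' (M : Set (Fin p)))

theorem colSpan_mono (X : Matrix (Fin n) (Fin p) ℝ) {M M' : Finset (Fin p)} (h : M ⊆ M') :
    colSpan X M ≤ colSpan X M' :=
  Submodule.span_mono (Set.image_mono (by exact_mod_cast h))

theorem toEuclideanLin_eq_sum (X : Matrix (Fin n) (Fin p) ℝ) (v : EuclideanSpace ℝ (Fin p)) :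
    X.toEuclideanLin v = ∑ j, v j • WithLp.toLp 2 (X.col j) := by
  ext i
  simp [Matrix.toLpLin_apply, Matrix.mulVec, dotProduct, mul_comm]

theorem toEuclideanLin_mem_colSpan (X : Matrix (Fin n) (Fin p) ℝ) {M : Finset (Fin p)}
    {v : EuclideanSpace ℝ (Fin p)} (hv : ∀ j ∉ M, v j = 0) :
    X.toEuclideanLin v ∈ colSpan X M := by
  rw [toEuclideanLin_eq_sum]
  refine Submodule.sum_mem _ fun j _ => ?_
  by_cases hj : j ∈ M
  · exact Submodule.smul_mem _ _ (Submodule.subset_span ⟨j, by exact_mod_cast hj, rfl⟩)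
  · simp [hv j hj]

theorem toEuclideanLin_mem_colSpan_univ (X : Matrix (Fin n) (Fin p) ℝ)
    (v : EuclideanSpace ℝ (Fin p)) : X.toEuclideanLin v ∈ colSpan X Finset.univ :=
  toEuclideanLin_mem_colSpan X (by simp)

theorem isSymm_gram_indicator (X : Matrix (Fin n) (Fin p) ℝ) (M : Finset (Fin p)) :
    (indicatorMatrix M * X.transpose * X * indicatorMatrix M).IsSymm := by
  simp [Matrix.IsSymm, Matrix.transpose_mul, indicatorMatrix, Matrix.mul_assoc]

theorem indicatorMatrix_mul_self (M : Finset (Fin p)) :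
    indicatorMatrix M * indicatorMatrix M = indicatorMatrix M := by
  simp [indicatorMatrix]

theorem transpose_indicatorMatrix (M : Finset (Fin p)) :
    (indicatorMatrix M).transpose = indicatorMatrix M := by
  simp [indicatorMatrix]

/-- The Penrose equations and the symmetry of `G` give `G⁺ = G (G⁺)ᵀ G⁺`, so the range of `G⁺` lies
in that of `G`, whose vectors are supported on `M`. -/
theorem indicatorMatrix_mul_pinv (X : Matrix (Fin n) (Fin p) ℝ) (M : Finset (Fin p)) :
    indicatorMatrix M * pinv (indicatorMatrix M * X.transpose * X * indicatorMatrix M) =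
      pinv (indicatorMatrix M * X.transpose * X * indicatorMatrix M) := by
  have hG := isSymm_gram_indicator X M
  have hB := isMoorePenrose_pinv hG
  set G := indicatorMatrix M * X.transpose * X * indicatorMatrix M with hGdef
  have hDG : indicatorMatrix M * G = G := by
    rw [hGdef]
    simp only [← Matrix.mul_assoc, indicatorMatrix_mul_self]
  have h : pinv G = G * ((pinv G).transpose * pinv G) := by
    conv_lhs => rw [← hB.mul_mul_inv, ← hB.symm_right, Matrix.transpose_mul, hG.eq]
    rw [Matrix.mul_assoc]
  rw [h, ← Matrix.mul_assoc, hDG]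

/-- The normal equations for the least squares estimate. -/
theorem normal_equations (X : Matrix (Fin n) (Fin p) ℝ) (M : Finset (Fin p)) :
    indicatorMatrix M * X.transpose *
      (X * (pinv (indicatorMatrix M * X.transpose * X * indicatorMatrix M) *
        indicatorMatrix M * X.transpose)) = indicatorMatrix M * X.transpose := by
  have hG := isSymm_gram_indicator X M
  have hB := isMoorePenrose_pinv hG
  have hDB := indicatorMatrix_mul_pinv X M
  set D := indicatorMatrix M with hD
  set G := D * X.transpose * X * D with hGdef
  set B := pinv G with hBdef
  have hDt : D.transpose = D := transpose_indicatorMatrix M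
  have hGA : G = (D * X.transpose) * (D * X.transpose).transpose := by
    rw [Matrix.transpose_mul, hDt, Matrix.transpose_transpose, hGdef]
    simp only [Matrix.mul_assoc]
  -- With `A = D X'` and `G = A Aᵀ`, the product of `(G B - 1) A` with its transpose contains `(G B
  -- - 1) G = 0`; a real matrix `C` with `C Cᵀ = 0` vanishes.
  have hC : (G * B - 1) * (D * X.transpose) = 0 := by
    have : ((G * B - 1) * (D * X.transpose)) * ((G * B - 1) * (D * X.transpose)).transpose = 0 := by
      rw [Matrix.transpose_mul, Matrix.mul_assoc, ← Matrix.mul_assoc (D * X.transpose), ← hGA,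
        ← Matrix.mul_assoc, Matrix.sub_mul, hB.mul_mul_self]
      simp
    rw [← Matrix.conjTranspose_eq_transpose_of_trivial] at this
    exact Matrix.self_mul_conjTranspose_eq_zero.1 this
  rw [Matrix.sub_mul, Matrix.one_mul, sub_eq_zero] at hC
  calc D * X.transpose * (X * (B * D * X.transpose))
      = D * X.transpose * (X * ((D * B) * D * X.transpose)) := by rw [hDB]
    _ = G * B * (D * X.transpose) := by rw [hGdef]; simp only [Matrix.mul_assoc]
    _ = D * X.transpose := hC

theorem toEuclideanLin_mul_apply {m : ℕ} (A : Matrix (Fin n) (Fin p) ℝ)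
    (B : Matrix (Fin p) (Fin m) ℝ) (v : EuclideanSpace ℝ (Fin m)) :
    (A * B).toEuclideanLin v = A.toEuclideanLin (B.toEuclideanLin v) := by
  simp [Matrix.toLpLin_apply, Matrix.mulVec_mulVec]

theorem indicatorMatrix_toEuclideanLin_apply (M : Finset (Fin p)) (v : EuclideanSpace ℝ (Fin p))
    (j : Fin p) : (indicatorMatrix M).toEuclideanLin v j = if j ∈ M then v j else 0 := by
  simp [indicatorMatrix, Matrix.toLpLin_apply, Matrix.mulVec_diagonal]

/-- The estimate is supported on `M`, so the fit lies in the column space; the normal equations make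
the residual orthogonal to each column of `M`. -/
theorem toEuclideanLin_lse (X : Matrix (Fin n) (Fin p) ℝ) (M : Finset (Fin p))
    (y : EuclideanSpace ℝ (Fin n)) :
    X.toEuclideanLin (lse X M y) = (colSpan X M).starProjection y := by
  symm
  apply Submodule.eq_starProjection_of_mem_of_inner_eq_zero
  · refine toEuclideanLin_mem_colSpan X fun j hj => ?_
    rw [lse, ← indicatorMatrix_mul_pinv, Matrix.mul_assoc, Matrix.mul_assoc,
      toEuclideanLin_mul_apply, indicatorMatrix_toEuclideanLin_apply, if_neg hj]
  · have key : (indicatorMatrix M * X.transpose).toEuclideanLin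
        (y - X.toEuclideanLin (lse X M y)) = 0 := by
      rw [map_sub, lse, ← toEuclideanLin_mul_apply X, ← toEuclideanLin_mul_apply,
        normal_equations, sub_self]
    intro w hw
    refine Submodule.span_induction (p := fun w _ =>
      ⟪y - X.toEuclideanLin (lse X M y), w⟫ = 0) ?_ ?_ ?_ ?_ hw
    · rintro _ ⟨j, hj, rfl⟩
      have h := congrArg (fun v : EuclideanSpace ℝ (Fin p) => v j) key
      rw [toEuclideanLin_mul_apply] at h
      have hj' : j ∈ M := by exact_mod_cast hj
      rw [indicatorMatrix_toEuclideanLin_apply, if_pos hj'] at h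
      rw [PiLp.inner_apply]
      simpa [Matrix.mulVec, dotProduct, mul_sub] using h
    · simp
    · intro a b _ _ ha hb
      rw [inner_add_right, ha, hb, add_zero]
    · intro c a _ ha
      rw [inner_smul_right, ha, mul_zero]

theorem finrank_colSpan_univ (X : Matrix (Fin n) (Fin p) ℝ) :
    Module.finrank ℝ (colSpan X Finset.univ) = X.rank := by
  rw [Matrix.rank_eq_finrank_span_cols, colSpan]
  have : (fun j => WithLp.toLp 2 (X.col j)) '' ((Finset.univ : Finset (Fin p)) : Set (Fin p)) =
      (WithLp.linearEquiv 2 ℝ (Fin n → ℝ)).symm '' (Set.range X.col) := by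
    rw [← Set.range_comp]
    simp
    rfl
  rw [this, Submodule.span_image_linearEquiv]
  exact LinearEquiv.finrank_map_eq _ _

theorem linearIndependent_toLp_col {X : Matrix (Fin n) (Fin p) ℝ}
    (hX : ColumnsInGeneralPosition X) {M : Finset (Fin p)} (hM : M.card ≤ X.rank) :
    LinearIndependent ℝ (fun j : M => WithLp.toLp 2 (X.col j)) := by
  obtain ⟨M', hMM', -, hM'⟩ := Finset.exists_subsuperset_card_eq (Finset.subset_univ M) hM
    (by rw [Finset.card_univ, Fintype.card_fin]; exact X.rank_le_width)
  have h := (hX M' hM').comp (fun j : M => (⟨j.1, hMM' j.2⟩ : M'))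
    (fun a b hab => Subtype.ext (congrArg (fun x : M' => x.1) hab))
  exact h.map' (WithLp.linearEquiv 2 ℝ (Fin n → ℝ)).symm.toLinearMap (LinearEquiv.ker _)

theorem finrank_colSpan {X : Matrix (Fin n) (Fin p) ℝ}
    (hX : ColumnsInGeneralPosition X) {M : Finset (Fin p)} (hM : M.card ≤ X.rank) :
    Module.finrank ℝ (colSpan X M) = M.card := by
  have h := finrank_span_eq_card (linearIndependent_toLp_col hX hM)
  rw [Fintype.card_coe] at h
  rw [← h, colSpan, Set.image_eq_range]
  rfl

theorem finrank_colSpan_le (X : Matrix (Fin n) (Fin p) ℝ) (M : Finset (Fin p)) :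
    Module.finrank ℝ (colSpan X M) ≤ M.card := by
  classical
  rw [colSpan, ← Finset.coe_image]
  exact (finrank_span_finset_le_card _).trans Finset.card_image_le

/-- By general position, `r` columns already span the whole column space. All models of size at
least `r` therefore fit alike and can be counted as one. -/
theorem colSpan_eq_univ {X : Matrix (Fin n) (Fin p) ℝ}
    (hX : ColumnsInGeneralPosition X) {M : Finset (Fin p)} (hM : X.rank ≤ M.card) :
    colSpan X M = colSpan X Finset.univ := by
  obtain ⟨M', hM'M, hM'⟩ := Finset.exists_subset_card_eq hM
  have h : colSpan X M' = colSpan X Finset.univ :=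
    Submodule.eq_of_le_of_finrank_eq (colSpan_mono X (Finset.subset_univ _))
      (by rw [finrank_colSpan hX hM'.le, finrank_colSpan_univ, hM'])
  exact le_antisymm (colSpan_mono X (Finset.subset_univ _)) (h ▸ colSpan_mono X hM'M)

end LinearAlgebra

end MAPSelection
namespace MAPSelection

/-! ### Penalized projections and exponential control of the noise. -/

section Penalized

open scoped RealInnerProductSpace

/-- The only property of `c(γ)` that the argument needs. -/
theorem two_mul_le_cGamma (γ : ℝ) : 2 * γ ≤ cGamma γ := by
  unfold cGamma
  nlinarith [sq_nonneg (γ + 3 / 4), sq_nonneg (γ - 3 / 4)]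

theorem neg_log_one_sub_le {x : ℝ} (h0 : 0 ≤ x) (h1 : x ≤ 1 / 2) :
    -Real.log (1 - x) ≤ 2 * x := by
  have hpos : 0 < 1 - x := by linarith
  have h := Real.log_le_sub_one_of_pos (inv_pos.2 hpos)
  rw [Real.log_inv] at h
  refine h.trans ?_
  rw [sub_le_iff_le_add, inv_le_iff_one_le_mul₀ hpos]
  nlinarith

/-- Here `w` is the model weight, and the power `k + 1` allows for the extra direction `μ`. The left
side contains `w ^ (1 + η)`; the factors `(1 + γ) ^ (k / 2)` cancel up to one square root, and the
spare `w ^ η ≤ exp (-2ηγk)` pays for `(1 - 2ηγ) ^ (-(k + 1) / 2) ≤ exp (2ηγ(k + 1))`. What remains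
is at most `exp (1 / 2)`, as `2ηγ ≤ 1 / 2`. -/
theorem exp_neg_mul_log_mul_inv_sqrt_pow_le {γ η w : ℝ} (hγ : 0 < γ) (hη : 0 < η)
    (hηγ : 4 * η * γ ≤ 1) (k : ℕ) (hw : 0 < w) (hwk : w ≤ Real.exp (-(cGamma γ * k))) :
    Real.exp (-((1 + η) * Real.log (w⁻¹ * (1 + γ) ^ ((k : ℝ) / 2)))) *
      (√(1 - γ * (1 + 2 * η) / (1 + γ)))⁻¹ ^ (k + 1) ≤
      w * Real.exp ((Real.log (1 + γ) + 1) / 2) := by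
  have hg : 0 < 1 + γ := by linarith
  have hx : 0 < 1 - 2 * η * γ := by nlinarith
  have heq : 1 - γ * (1 + 2 * η) / (1 + γ) = (1 - 2 * η * γ) / (1 + γ) := by
    field_simp
    ring
  have hq : 0 < (1 - 2 * η * γ) / (1 + γ) := div_pos hx hg
  have hlogw : Real.log w ≤ -(cGamma γ * k) := by
    rwa [← Real.log_exp (-(cGamma γ * k)), Real.log_le_log_iff hw (Real.exp_pos _)]
  have hs : (√((1 - 2 * η * γ) / (1 + γ)))⁻¹ ^ (k + 1) =
      Real.exp (-((k + 1) / 2 * (Real.log (1 - 2 * η * γ) - Real.log (1 + γ)))) := by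
    have hsq : 0 < (√((1 - 2 * η * γ) / (1 + γ)))⁻¹ := inv_pos.2 (Real.sqrt_pos.2 hq)
    rw [← Real.exp_log (pow_pos hsq _), Real.log_pow, Real.log_inv, Real.log_sqrt hq.le,
      Real.log_div hx.ne' hg.ne']
    congr 1
    push_cast
    ring
  have hl : Real.log (w⁻¹ * (1 + γ) ^ ((k : ℝ) / 2)) =
      -Real.log w + k / 2 * Real.log (1 + γ) := by
    rw [Real.log_mul (inv_ne_zero hw.ne') (Real.rpow_pos_of_pos hg _).ne', Real.log_inv,
      Real.log_rpow hg]
  rw [heq, hs, hl, ← Real.exp_add]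
  conv_rhs => rw [← Real.exp_log hw, ← Real.exp_add]
  rw [Real.exp_le_exp]
  have h1 := neg_log_one_sub_le (x := 2 * η * γ) (by positivity) (by linarith)
  have h2 : 0 ≤ Real.log (1 + γ) := Real.log_nonneg (by linarith)
  have hk : (0 : ℝ) ≤ k := k.cast_nonneg
  have h3 : η * Real.log w ≤ -(η * (2 * γ) * k) := by
    have := mul_le_mul_of_nonneg_right (two_mul_le_cGamma γ) hk
    nlinarith
  have h4 : (k + 1 : ℝ) / 2 * (-Real.log (1 - 2 * η * γ)) ≤
      (k + 1 : ℝ) / 2 * (2 * (2 * η * γ)) := mul_le_mul_of_nonneg_left h1 (by positivity)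
  have h5 : 0 ≤ η * (k / 2 * Real.log (1 + γ)) := by positivity
  nlinarith

variable {E : Type*} [NormedAddCommGroup E] [InnerProductSpace ℝ E] [FiniteDimensional ℝ E]

theorem norm_sub_starProjection_le (V : Submodule ℝ E) (y : E) {f : E} (hf : f ∈ V) :
    ‖y - V.starProjection y‖ ≤ ‖y - f‖ := by
  rw [Submodule.starProjection_minimal]
  exact ciInf_le ⟨0, by rintro _ ⟨x, rfl⟩; positivity⟩ (⟨f, hf⟩ : V)

theorem two_mul_inner_le_of_mem (W : Submodule ℝ E) {a : ℝ} (ha : 0 < a) (ε : E) {g : E}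
    (hg : g ∈ W) : 2 * ⟪ε, g⟫ ≤ a * ‖g‖ ^ 2 + a⁻¹ * ‖W.starProjection ε‖ ^ 2 := by
  have h : ⟪ε, g⟫ = ⟪W.starProjection ε, g⟫ := by
    rw [Submodule.inner_starProjection_left_eq_right, Submodule.starProjection_eq_self_iff.2 hg]
  have h1 := real_inner_le_norm (W.starProjection ε) g
  have h2 : 2 * (‖W.starProjection ε‖ * ‖g‖) ≤
      a * ‖g‖ ^ 2 + a⁻¹ * ‖W.starProjection ε‖ ^ 2 := by
    have := mul_nonneg (inv_pos.2 ha).le (sq_nonneg (a * ‖g‖ - ‖W.starProjection ε‖))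
    have e : a⁻¹ * (a * ‖g‖ - ‖W.starProjection ε‖) ^ 2 =
        a * ‖g‖ ^ 2 + a⁻¹ * ‖W.starProjection ε‖ ^ 2 - 2 * (‖W.starProjection ε‖ * ‖g‖) := by
      field_simp
      ring
    linarith
  rw [h]
  linarith

/-- The basic inequality for penalized projection estimators. -/
theorem one_sub_mul_norm_sq_le_of_penalized_le (V W : Submodule ℝ E) {a q s : ℝ} (ha : 0 < a)
    (μ ε : E)
    (h : ‖μ + ε - W.starProjection (μ + ε)‖ ^ 2 + s ≤
      ‖μ + ε - V.starProjection (μ + ε)‖ ^ 2 + q) :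
    (1 - a) * ‖W.starProjection (μ + ε) - μ‖ ^ 2 ≤
      ‖V.starProjection μ - μ‖ ^ 2 + q + 2 * ⟪μ - V.starProjection μ, ε⟫ +
        (a⁻¹ * ‖(W ⊔ Submodule.span ℝ {μ}).starProjection ε‖ ^ 2 - s) := by
  have hexp : ∀ f : E, ‖μ + ε - f‖ ^ 2 = ‖f - μ‖ ^ 2 + 2 * ⟪μ - f, ε⟫ + ‖ε‖ ^ 2 := fun f => by
    rw [show μ + ε - f = (μ - f) + ε by abel, norm_add_sq_real, norm_sub_rev f]
  -- Replacing the competitor's fit by the projection of `μ` makes the remaining linear noise term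
  -- deterministic in direction, hence of mean zero.
  have hmin : ‖μ + ε - V.starProjection (μ + ε)‖ ^ 2 ≤ ‖μ + ε - V.starProjection μ‖ ^ 2 := by
    have := norm_sub_starProjection_le V (μ + ε) (V.starProjection_apply_mem μ)
    gcongr
  -- Adjoining `μ` puts the error into a space that is independent of the noise for each fixed `W`.
  have hmem : W.starProjection (μ + ε) - μ ∈ W ⊔ Submodule.span ℝ {μ} :=
    Submodule.sub_mem _ (Submodule.mem_sup_left (W.starProjection_apply_mem _))
      (Submodule.mem_sup_right (Submodule.mem_span_singleton_self μ))
  have hin := two_mul_inner_le_of_mem _ ha ε hmem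
  have hneg : ⟪μ - W.starProjection (μ + ε), ε⟫ = -⟪ε, W.starProjection (μ + ε) - μ⟫ := by
    rw [real_inner_comm, ← inner_neg_right, neg_sub]
  simp only [hexp] at h hmin
  rw [hneg] at h
  linarith

theorem norm_starProjection_add_sub_sq (V : Submodule ℝ E) (μ ε : E) :
    ‖V.starProjection (μ + ε) - μ‖ ^ 2 =
      ‖V.starProjection μ - μ‖ ^ 2 + ‖V.starProjection ε‖ ^ 2 := by
  have h0 : ⟪V.starProjection μ - μ, V.starProjection ε⟫ = 0 := by
    rw [← neg_sub, inner_neg_left,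
      Submodule.starProjection_inner_eq_zero μ _ (V.starProjection_apply_mem ε), neg_zero]
  rw [map_add, show V.starProjection μ + V.starProjection ε - μ =
    (V.starProjection μ - μ) + V.starProjection ε by abel, norm_add_sq_real, h0]
  ring

theorem finrank_sup_span_singleton_le (V : Submodule ℝ E) (μ : E) :
    Module.finrank ℝ (V ⊔ Submodule.span ℝ {μ} : Submodule ℝ E) ≤ Module.finrank ℝ V + 1 := by
  refine (Submodule.finrank_add_le_finrank_add_finrank _ _).trans ?_
  gcongr
  exact (finrank_span_le_card ({μ} : Set E)).trans (by simp)

theorem le_mul_exp_div {κ : ℝ} (hκ : 0 < κ) (x : ℝ) : x ≤ κ * Real.exp (x / κ) := by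
  have h := Real.add_one_le_exp (x / κ)
  calc x = κ * (x / κ) := by field_simp
    _ ≤ κ * Real.exp (x / κ) := by gcongr; linarith

theorem norm_starProjection_sq_eq_mul {σ : ℝ} (hσ : 0 < σ) (V : Submodule ℝ E) (x : E) :
    ‖V.starProjection x‖ ^ 2 = σ ^ 2 * ‖V.starProjection (σ⁻¹ • x)‖ ^ 2 := by
  rw [map_smul, norm_smul, Real.norm_eq_abs, mul_pow, sq_abs]
  field_simp

theorem mul_exp_excess_eq {σ : ℝ} (hσ : 0 < σ) (W : Submodule ℝ E) (a κ q : ℝ) (x : E) :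
    κ * Real.exp ((a⁻¹ * ‖W.starProjection x‖ ^ 2 - q) / κ) =
      κ * Real.exp (-(q / κ)) *
        Real.exp (σ ^ 2 / (a * κ) * ‖W.starProjection (σ⁻¹ • x)‖ ^ 2) := by
  rw [mul_assoc, ← Real.exp_add, norm_starProjection_sq_eq_mul hσ]
  congr 2
  rw [div_mul_eq_div_div]
  ring

section Noise

variable [MeasurableSpace E] [BorelSpace E]
  {Ω : Type*} [MeasurableSpace Ω] {P : Measure Ω} {ε : Ω → E} {σ : ℝ}

theorem integrable_norm_starProjection_noise_sq (hσ : 0 < σ)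
    (h : HasLaw (fun ω => σ⁻¹ • ε ω) (stdGaussian E) P) (V : Submodule ℝ E) :
    Integrable (fun ω => ‖V.starProjection (ε ω)‖ ^ 2) P := by
  simp_rw [fun ω => norm_starProjection_sq_eq_mul hσ V (ε ω)]
  exact (integrable_norm_starProjection_sq h V).const_mul _

theorem integral_norm_starProjection_noise_sq (hσ : 0 < σ)
    (h : HasLaw (fun ω => σ⁻¹ • ε ω) (stdGaussian E) P) (V : Submodule ℝ E) :
    ∫ ω, ‖V.starProjection (ε ω)‖ ^ 2 ∂P = σ ^ 2 * Module.finrank ℝ V := by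
  simp_rw [fun ω => norm_starProjection_sq_eq_mul hσ V (ε ω)]
  rw [integral_const_mul, integral_norm_starProjection_sq h V]

theorem integrable_inner_noise (hσ : 0 < σ)
    (h : HasLaw (fun ω => σ⁻¹ • ε ω) (stdGaussian E) P) (v : E) :
    Integrable (fun ω => ⟪v, ε ω⟫) P := by
  have := ((integrable_of_hasLaw_stdGaussian h).const_inner v).const_mul σ
  refine this.congr (Filter.Eventually.of_forall fun ω => ?_)
  simp only [inner_smul_right]
  field_simp

theorem integral_inner_noise (hσ : 0 < σ)
    (h : HasLaw (fun ω => σ⁻¹ • ε ω) (stdGaussian E) P) (v : E) :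
    ∫ ω, ⟪v, ε ω⟫ ∂P = 0 := by
  have := integral_inner_eq_zero_of_hasLaw_stdGaussian h v
  simp_rw [inner_smul_right] at this
  rw [integral_const_mul] at this
  exact (mul_eq_zero.1 this).resolve_left (inv_ne_zero hσ.ne')

theorem integrable_mul_exp_excess (hσ : 0 < σ)
    (h : HasLaw (fun ω => σ⁻¹ • ε ω) (stdGaussian E) P) (W : Submodule ℝ E) {a κ : ℝ} (q : ℝ)
    (ht : σ ^ 2 / (a * κ) < 1 / 2) :
    Integrable (fun ω => κ * Real.exp ((a⁻¹ * ‖W.starProjection (ε ω)‖ ^ 2 - q) / κ)) P := by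
  simp_rw [mul_exp_excess_eq hσ]
  exact (integrable_exp_mul_norm_starProjection_sq h W ht).const_mul _

theorem integral_mul_exp_excess_le (hσ : 0 < σ)
    (h : HasLaw (fun ω => σ⁻¹ • ε ω) (stdGaussian E) P) (W : Submodule ℝ E) {a κ : ℝ} (q : ℝ)
    (ha : 0 < a) (hκ : 0 < κ) (ht : σ ^ 2 / (a * κ) < 1 / 2) {d : ℕ}
    (hd : Module.finrank ℝ W ≤ d) :
    ∫ ω, κ * Real.exp ((a⁻¹ * ‖W.starProjection (ε ω)‖ ^ 2 - q) / κ) ∂P ≤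
      κ * (Real.exp (-(q / κ)) * (√(1 - 2 * (σ ^ 2 / (a * κ))))⁻¹ ^ d) := by
  simp_rw [mul_exp_excess_eq hσ]
  rw [integral_const_mul, integral_exp_mul_norm_starProjection_sq h W ht, mul_assoc]
  have hpos : 0 < σ ^ 2 / (a * κ) := by positivity
  have h1 : 1 ≤ (√(1 - 2 * (σ ^ 2 / (a * κ))))⁻¹ := by
    rw [one_le_inv₀ (Real.sqrt_pos.2 (by linarith))]
    exact Real.sqrt_le_one.2 (by linarith)
  gcongr

end Noise

end Penalized

end MAPSelection
namespace MAPSelection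

/-! ### Oracle inequality with the competitor's penalty. -/

section Oracle

open scoped RealInnerProductSpace

variable {n p : ℕ} {X : Matrix (Fin n) (Fin p) ℝ} {σ : ℝ} {π : ℕ → ℝ}
  {β : EuclideanSpace ℝ (Fin p)} {Ω : Type*} [MeasurableSpace Ω] {P : Measure Ω}
  {ε y : Ω → EuclideanSpace ℝ (Fin n)}

theorem loss_add (X : Matrix (Fin n) (Fin p) ℝ) (β : EuclideanSpace ℝ (Fin p))
    (M : Finset (Fin p)) (e : EuclideanSpace ℝ (Fin n)) :
    loss X β M (X.toEuclideanLin β + e) =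
      ‖(colSpan X M).starProjection (X.toEuclideanLin β) - X.toEuclideanLin β‖ ^ 2 +
        ‖(colSpan X M).starProjection e‖ ^ 2 := by
  rw [loss, toEuclideanLin_lse, norm_starProjection_add_sub_sq]

theorem integrable_loss [IsFiniteMeasure P] (hσ : 0 < σ)
    (h : HasLaw (fun ω => σ⁻¹ • ε ω) (stdGaussian (EuclideanSpace ℝ (Fin n))) P)
    (hy : ∀ ω, y ω = X.toEuclideanLin β + ε ω) (M : Finset (Fin p)) :
    Integrable (fun ω => loss X β M (y ω)) P := by
  simp_rw [hy, loss_add]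
  exact (integrable_const _).add (integrable_norm_starProjection_noise_sq hσ h _)

theorem integral_loss [IsProbabilityMeasure P] (hσ : 0 < σ)
    (h : HasLaw (fun ω => σ⁻¹ • ε ω) (stdGaussian (EuclideanSpace ℝ (Fin n))) P)
    (hy : ∀ ω, y ω = X.toEuclideanLin β + ε ω) (M : Finset (Fin p)) :
    ∫ ω, loss X β M (y ω) ∂P =
      ‖(colSpan X M).starProjection (X.toEuclideanLin β) - X.toEuclideanLin β‖ ^ 2 +
        σ ^ 2 * Module.finrank ℝ (colSpan X M) := by
  simp_rw [hy, loss_add]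
  rw [integral_add (integrable_const _) (integrable_norm_starProjection_noise_sq hσ h _),
    integral_norm_starProjection_noise_sq hσ h]
  simp

/-- There are finitely many models, so the selected loss is almost everywhere a finite sum of
fixed-model losses cut off to measurable events. -/
theorem integrable_loss_selected [IsFiniteMeasure P] (hσ : 0 < σ)
    (h : HasLaw (fun ω => σ⁻¹ • ε ω) (stdGaussian (EuclideanSpace ℝ (Fin n))) P)
    (hy : ∀ ω, y ω = X.toEuclideanLin β + ε ω) {Mhat : Ω → Finset (Fin p)}
    (hM : AEMeasurable Mhat P) : Integrable (fun ω => loss X β (Mhat ω) (y ω)) P := by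
  classical
  have hae : (fun ω => ∑ M, (hM.mk Mhat ⁻¹' {M}).indicator (fun ω => loss X β M (y ω)) ω)
      =ᵐ[P] fun ω => loss X β (Mhat ω) (y ω) := by
    filter_upwards [hM.ae_eq_mk] with ω hω
    rw [Finset.sum_eq_single (Mhat ω)]
    · rw [Set.indicator_of_mem]
      simp [hω]
    · intro M _ hne
      rw [Set.indicator_of_notMem]
      simpa [← hω] using hne.symm
    · simp
  refine Integrable.congr (integrable_finsetSum _ fun M _ => ?_) hae
  exact (integrable_loss hσ h hy M).indicator (hM.measurable_mk (measurableSet_singleton M))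

/-- Prior mass of a single distinguishable model of size `k`. -/
noncomputable def modelWeight (p r : ℕ) (π : ℕ → ℝ) (k : ℕ) : ℝ := π k / modelCount p r k

theorem modelCount_pos {p r k : ℕ} (hr : r ≤ p) : 0 < modelCount p r k := by
  unfold modelCount
  split_ifs with hk
  · exact_mod_cast Nat.choose_pos (hk.le.trans hr)
  · exact one_pos

theorem modelWeight_pos {r : ℕ} (hr : r ≤ p) (hπ : IsSizePrior r π) {k : ℕ} (hk : k ≤ r) :
    0 < modelWeight p r π k :=
  div_pos (hπ.pos k hk) (modelCount_pos hr)

theorem modelWeight_le {r : ℕ} {γ : ℝ} (hr : r ≤ p) (hP : AssumptionP p r γ π) {k : ℕ}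
    (hk : k ≤ r) : modelWeight p r π k ≤ Real.exp (-(cGamma γ * k)) := by
  rw [modelWeight, div_le_iff₀ (modelCount_pos hr), modelCount]
  split_ifs with h
  · rw [mul_comm]
    exact hP.1 k h
  · obtain rfl : k = r := by omega
    simpa using hP.2

/-- The `p.choose k` models of size `k < r` share the mass `π k` equally, and the saturated model
carries `π r` once. -/
theorem sum_modelWeight {r : ℕ} (hr : r ≤ p) (hπ : IsSizePrior r π) :
    ∑ M : Finset (Fin p) with M.card < r, modelWeight p r π M.card + modelWeight p r π r = 1 := by
  have h1 : ∑ M : Finset (Fin p) with M.card < r, modelWeight p r π M.card =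
      ∑ k ∈ Finset.range (p + 1), if k < r then π k else 0 := by
    rw [Finset.sum_filter, ← Finset.powerset_univ,
      Finset.sum_powerset_apply_card (fun k => if k < r then modelWeight p r π k else 0)]
    simp only [Finset.card_univ, Fintype.card_fin]
    refine Finset.sum_congr rfl fun k hk => ?_
    split_ifs with hkr
    · have : (p.choose k : ℝ) ≠ 0 := by exact_mod_cast (Nat.choose_pos (hkr.le.trans hr)).ne'
      rw [modelWeight, modelCount, if_pos hkr, nsmul_eq_mul]
      field_simp
    · simp
  have h2 : ∑ k ∈ Finset.range (p + 1), (if k < r then π k else 0) =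
      ∑ k ∈ Finset.range r, π k := by
    rw [← Finset.sum_filter]
    congr 1
    ext k
    simp only [Finset.mem_filter, Finset.mem_range]
    omega
  rw [h1, h2, modelWeight, modelCount, if_neg (lt_irrefl r), div_one, ← Finset.sum_range_succ,
    hπ.sum_eq_one]

theorem penalty_eq_modelWeight (p r : ℕ) (σ γ : ℝ) (π : ℕ → ℝ) (k : ℕ) :
    penalty p r σ γ π k = 2 * σ ^ 2 * (1 + 1 / γ) *
      Real.log ((modelWeight p r π k)⁻¹ * (1 + γ) ^ ((k : ℝ) / 2)) := by
  rw [penalty, modelWeight, inv_div, div_eq_mul_inv (modelCount p r k)]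

/-- The exponential bound for the positive part of the penalized noise in the space `W`. -/
noncomputable def excess (a κ q : ℝ) (W : Submodule ℝ (EuclideanSpace ℝ (Fin n)))
    (μ e : EuclideanSpace ℝ (Fin n)) : ℝ :=
  κ * Real.exp ((a⁻¹ * ‖(W ⊔ Submodule.span ℝ {μ}).starProjection e‖ ^ 2 - q) / κ)

theorem excess_nonneg {a κ : ℝ} (hκ : 0 ≤ κ) (q : ℝ)
    (W : Submodule ℝ (EuclideanSpace ℝ (Fin n))) (μ e : EuclideanSpace ℝ (Fin n)) :
    0 ≤ excess a κ q W μ e :=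
  mul_nonneg hκ (Real.exp_pos _).le

/-- This union bound removes the dependence of the model on the noise. Models of size `r` all
contribute the same single saturated term, so the weights do not overcount. -/
theorem excess_le_sum {γ a κ : ℝ} (hX : ColumnsInGeneralPosition X) (hκ : 0 ≤ κ)
    (μ e : EuclideanSpace ℝ (Fin n)) {M : Finset (Fin p)} (hM : M.card ≤ X.rank) :
    excess a κ (penalty p X.rank σ γ π M.card) (colSpan X M) μ e ≤
      ∑ M' : Finset (Fin p) with M'.card < X.rank,
        excess a κ (penalty p X.rank σ γ π M'.card) (colSpan X M') μ e +
      excess a κ (penalty p X.rank σ γ π X.rank) (colSpan X Finset.univ) μ e := by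
  rcases hM.lt_or_eq with h | h
  · refine le_add_of_le_of_nonneg ?_ (excess_nonneg hκ _ _ _ _)
    have hmem : M ∈ Finset.univ.filter fun M' : Finset (Fin p) => M'.card < X.rank :=
      Finset.mem_filter.2 ⟨Finset.mem_univ M, h⟩
    obtain ⟨f, hf⟩ : ∃ f : Finset (Fin p) → ℝ, ∀ M', f M' =
      excess a κ (penalty p X.rank σ γ π M'.card) (colSpan X M') μ e := ⟨_, fun _ => rfl⟩
    simp only [← hf]
    exact Finset.single_le_sum (fun M' _ => hf M' ▸ excess_nonneg hκ _ _ _ _) hmem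
  · rw [h, colSpan_eq_univ hX h.ge]
    exact le_add_of_nonneg_left (Finset.sum_nonneg fun M' _ => excess_nonneg hκ _ _ _ _)

theorem integral_excess_le {γ η : ℝ} (hγ : 0 < γ) (hη : 0 < η) (hηγ : 4 * η * γ ≤ 1)
    (hσ : 0 < σ) (h : HasLaw (fun ω => σ⁻¹ • ε ω) (stdGaussian (EuclideanSpace ℝ (Fin n))) P)
    {r : ℕ} (hr : r ≤ p) (hπ : IsSizePrior r π) (hP : AssumptionP p r γ π) {k : ℕ} (hk : k ≤ r)
    {a κ : ℝ} (ha : a = (1 + η) / (1 + 2 * η)) (hκ : κ = 2 * σ ^ 2 * (1 + 1 / γ) / (1 + η))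
    {W : Submodule ℝ (EuclideanSpace ℝ (Fin n))} (hW : Module.finrank ℝ W ≤ k)
    (μ : EuclideanSpace ℝ (Fin n)) :
    Integrable (fun ω => excess a κ (penalty p r σ γ π k) W μ (ε ω)) P ∧
    ∫ ω, excess a κ (penalty p r σ γ π k) W μ (ε ω) ∂P ≤
      κ * Real.exp ((Real.log (1 + γ) + 1) / 2) * modelWeight p r π k := by
  -- `a` and `κ` are tuned so that `Pen / κ` is `1 + η` times the logarithm, while the Laplace
  -- parameter stays below the critical `1 / 2`, which requires `2ηγ < 1`.
  have ht : 2 * (σ ^ 2 / (a * κ)) = γ * (1 + 2 * η) / (1 + γ) := by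
    rw [ha, hκ]
    field_simp
    ring
  have ht2 : σ ^ 2 / (a * κ) < 1 / 2 := by
    have : γ * (1 + 2 * η) / (1 + γ) < 1 := by
      rw [div_lt_one (by linarith)]
      nlinarith
    linarith
  have hκ0 : 0 < κ := by rw [hκ]; positivity
  have ha0 : 0 < a := by rw [ha]; positivity
  have hq : penalty p r σ γ π k / κ =
      (1 + η) * Real.log ((modelWeight p r π k)⁻¹ * (1 + γ) ^ ((k : ℝ) / 2)) := by
    rw [penalty_eq_modelWeight, hκ]
    field_simp
  refine ⟨integrable_mul_exp_excess hσ h _ _ ht2, ?_⟩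
  refine (integral_mul_exp_excess_le hσ h _ _ ha0 hκ0 ht2 (d := k + 1)
    ((finrank_sup_span_singleton_le W μ).trans (by omega))).trans ?_
  have := exp_neg_mul_log_mul_inv_sqrt_pow_le hγ hη hηγ k (modelWeight_pos hr hπ hk)
    (modelWeight_le hr hP hk)
  rw [hq, ht, mul_assoc]
  refine mul_le_mul_of_nonneg_left ?_ hκ0.le
  linarith

/-- The oracle inequality with the penalty of the competing model. -/
theorem integral_loss_map_le [IsProbabilityMeasure P] {γ η : ℝ} (hγ : 0 < γ) (hη : 0 < η)
    (hηγ : 4 * η * γ ≤ 1) (hσ : 0 < σ) (hX : ColumnsInGeneralPosition X)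
    (h : HasLaw (fun ω => σ⁻¹ • ε ω) (stdGaussian (EuclideanSpace ℝ (Fin n))) P)
    (hy : ∀ ω, y ω = X.toEuclideanLin β + ε ω)
    (hπ : IsSizePrior X.rank π) (hP : AssumptionP p X.rank γ π)
    {Mhat : Ω → Finset (Fin p)} (hMhat : AEMeasurable Mhat P)
    (hMAP : ∀ᵐ ω ∂P, IsMAPModel X σ γ π (y ω) (Mhat ω))
    {M : Finset (Fin p)} (hM : M.card ≤ X.rank) :
    η / (1 + 2 * η) * ∫ ω, loss X β (Mhat ω) (y ω) ∂P ≤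
      ‖(colSpan X M).starProjection (X.toEuclideanLin β) - X.toEuclideanLin β‖ ^ 2 +
        penalty p X.rank σ γ π M.card +
        2 * σ ^ 2 * (1 + 1 / γ) / (1 + η) * Real.exp ((Real.log (1 + γ) + 1) / 2) := by
  have hr : X.rank ≤ p := X.rank_le_width
  obtain ⟨a, ha⟩ : ∃ a, a = (1 + η) / (1 + 2 * η) := ⟨_, rfl⟩
  obtain ⟨κ, hκ⟩ : ∃ κ, κ = 2 * σ ^ 2 * (1 + 1 / γ) / (1 + η) := ⟨_, rfl⟩
  have hκ0 : 0 < κ := by rw [hκ]; positivity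
  have ha0 : 0 < a := by rw [ha]; positivity
  have h1a : η / (1 + 2 * η) = 1 - a := by
    rw [ha]
    field_simp
    ring
  rw [← hκ, h1a]
  set μ := X.toEuclideanLin β with hμ
  set B := ‖(colSpan X M).starProjection μ - μ‖ ^ 2 with hB
  set K := Real.exp ((Real.log (1 + γ) + 1) / 2) with hK
  have hsum := fun M' (hM' : M' ∈ Finset.univ.filter fun M' : Finset (Fin p) =>
      M'.card < X.rank) =>
    integral_excess_le hγ hη hηγ hσ h hr hπ hP (Finset.mem_filter.1 hM').2.le ha hκ
      (finrank_colSpan_le X M') μ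
  have hfull := integral_excess_le hγ hη hηγ hσ h hr hπ hP le_rfl ha hκ
    (finrank_colSpan_univ X).le μ
  have hin := integrable_inner_noise hσ h (μ - (colSpan X M).starProjection μ)
  have hle : ∀ᵐ ω ∂P, (1 - a) * loss X β (Mhat ω) (y ω) ≤
      B + penalty p X.rank σ γ π M.card +
        2 * ⟪μ - (colSpan X M).starProjection μ, ε ω⟫ +
        (∑ M' : Finset (Fin p) with M'.card < X.rank,
          excess a κ (penalty p X.rank σ γ π M'.card) (colSpan X M') μ (ε ω) +
        excess a κ (penalty p X.rank σ γ π X.rank) (colSpan X Finset.univ) μ (ε ω)) := by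
    filter_upwards [hMAP] with ω hω
    have hc := hω.2 M hM
    simp only [criterion, toEuclideanLin_lse, hy ω] at hc
    have hb := one_sub_mul_norm_sq_le_of_penalized_le _ _ ha0 μ (ε ω) hc
    rw [loss, toEuclideanLin_lse, hy ω]
    refine hb.trans ?_
    have he := (le_mul_exp_div hκ0 _).trans
      (excess_le_sum (σ := σ) (π := π) (γ := γ) (a := a) hX hκ0.le μ (ε ω) hω.1)
    exact add_le_add le_rfl he
  have hi1 : Integrable (fun ω => B + penalty p X.rank σ γ π M.card +
      2 * ⟪μ - (colSpan X M).starProjection μ, ε ω⟫) P :=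
    (integrable_const _).add (hin.const_mul 2)
  have hi2 := integrable_finsetSum _ fun M' hM' => (hsum M' hM').1
  have hi3 := hi2.add hfull.1
  have hint := integral_mono_ae ((integrable_loss_selected hσ h hy hMhat).const_mul (1 - a))
    (hi1.add hi3) hle
  simp only [Pi.add_apply] at hint
  rw [integral_const_mul] at hint
  refine hint.trans ?_
  have e1 : ∫ ω, (B + penalty p X.rank σ γ π M.card +
      2 * ⟪μ - (colSpan X M).starProjection μ, ε ω⟫) ∂P =
      B + penalty p X.rank σ γ π M.card := by
    rw [integral_add (integrable_const _) (hin.const_mul 2), integral_const_mul,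
      integral_inner_noise hσ h]
    simp
  have e2 : ∫ ω, (∑ M' : Finset (Fin p) with M'.card < X.rank,
          excess a κ (penalty p X.rank σ γ π M'.card) (colSpan X M') μ (ε ω) +
        excess a κ (penalty p X.rank σ γ π X.rank) (colSpan X Finset.univ) μ (ε ω)) ∂P ≤
      κ * K := by
    rw [integral_add hi2 hfull.1, integral_finsetSum _ fun M' hM' => (hsum M' hM').1]
    refine (add_le_add (Finset.sum_le_sum fun M' hM' => (hsum M' hM').2) hfull.2).trans ?_
    rw [← Finset.mul_sum, ← mul_add, sum_modelWeight hr hπ, mul_one]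
  have e3 : ∫ ω, (B + penalty p X.rank σ γ π M.card +
        2 * ⟪μ - (colSpan X M).starProjection μ, ε ω⟫ +
        (∑ M' : Finset (Fin p) with M'.card < X.rank,
          excess a κ (penalty p X.rank σ γ π M'.card) (colSpan X M') μ (ε ω) +
        excess a κ (penalty p X.rank σ γ π X.rank) (colSpan X Finset.univ) μ (ε ω))) ∂P =
      ∫ ω, (B + penalty p X.rank σ γ π M.card +
        2 * ⟪μ - (colSpan X M).starProjection μ, ε ω⟫) ∂P +
      ∫ ω, (∑ M' : Finset (Fin p) with M'.card < X.rank,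
          excess a κ (penalty p X.rank σ γ π M'.card) (colSpan X M') μ (ε ω) +
        excess a κ (penalty p X.rank σ γ π X.rank) (colSpan X Finset.univ) μ (ε ω)) ∂P :=
    integral_add hi1 hi3
  linarith

end Oracle

end MAPSelection
namespace MAPSelection

/-! ### Logarithmic size of the penalty and degenerate cases. -/

section LogPenalty

open scoped RealInnerProductSpace

theorem log_modelCount_le {p r k : ℕ} (hp : 2 ≤ p) (hr : r ≤ p) :
    Real.log (modelCount p r k) ≤ k * Real.log p := by
  have hp1 : (1 : ℝ) ≤ p := by exact_mod_cast (by omega : 1 ≤ p)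
  rw [← Real.log_pow, Real.log_le_log_iff (modelCount_pos hr) (by positivity), modelCount]
  split_ifs
  · exact_mod_cast Nat.choose_le_pow p k
  · exact one_le_pow₀ hp1

theorem one_le_two_mul_log {p : ℕ} (hp : 2 ≤ p) : 1 ≤ 2 * Real.log p := by
  have h := Real.log_le_log (by norm_num : (0 : ℝ) < 2) (by exact_mod_cast hp : (2 : ℝ) ≤ p)
  linarith [Real.log_two_gt_d9]

theorem penalty_le_log {p r k : ℕ} {σ γ c : ℝ} {π : ℕ → ℝ} (hγ : 0 < γ) (hc : 0 ≤ c)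
    (hp : 2 ≤ p) (hr : r ≤ p) (hπ : IsSizePrior r π) (h0 : (p : ℝ) ^ (-c) ≤ π 0)
    (h1 : ∀ k : ℕ, 1 ≤ k → k ≤ r → (p : ℝ) ^ (-(c * k)) ≤ π k) (hk : k ≤ r) :
    penalty p r σ γ π k ≤
      2 * (1 + 1 / γ) * (1 + c + Real.log (1 + γ)) * (σ ^ 2 * (k + 1)) * Real.log p := by
  have hp0 : (0 : ℝ) < p := by exact_mod_cast (by omega : 0 < p)
  have hg : 0 < 1 + γ := by linarith
  have hl := one_le_two_mul_log hp
  have hlg : 0 ≤ Real.log (1 + γ) := Real.log_nonneg (by linarith)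
  have hk0 : (0 : ℝ) ≤ k := k.cast_nonneg
  -- The exponent `k + 1` instead of `k` covers `k = 0`, where the prior bound is `p ^ (-c)`,
  -- together with `k ≥ 1`.
  have hπk : -Real.log (π k) ≤ c * (k + 1) * Real.log p := by
    have hmono : (p : ℝ) ^ (-(c * (k + 1))) ≤ π k := by
      rcases Nat.eq_zero_or_pos k with rfl | hpos
      · simpa using h0
      · refine le_trans (Real.rpow_le_rpow_of_exponent_le ?_ ?_) (h1 k hpos hk)
        · exact_mod_cast (by omega : 1 ≤ p)
        · nlinarith
    have := Real.log_le_log (Real.rpow_pos_of_pos hp0 _) hmono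
    rw [Real.log_rpow hp0] at this
    linarith
  have hcount := log_modelCount_le (k := k) hp hr
  have hlog : Real.log (modelCount p r k * (π k)⁻¹ * (1 + γ) ^ ((k : ℝ) / 2)) ≤
      (1 + c + Real.log (1 + γ)) * (k + 1) * Real.log p := by
    have hπ0 := hπ.pos k hk
    have hm : modelCount p r k ≠ 0 := (modelCount_pos hr).ne'
    rw [Real.log_mul (mul_ne_zero hm (inv_ne_zero hπ0.ne')) (Real.rpow_pos_of_pos hg _).ne',
      Real.log_mul hm (inv_ne_zero hπ0.ne'), Real.log_inv, Real.log_rpow hg]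
    have hlast : (k : ℝ) / 2 * Real.log (1 + γ) ≤ Real.log (1 + γ) * (k + 1) * Real.log p := by
      have : (k : ℝ) / 2 * Real.log (1 + γ) * 1 ≤
          (k : ℝ) / 2 * Real.log (1 + γ) * (2 * Real.log p) :=
        mul_le_mul_of_nonneg_left hl (by positivity)
      have := mul_nonneg hlg (by linarith : 0 ≤ Real.log p)
      nlinarith
    nlinarith
  rw [penalty]
  calc _ ≤ 2 * σ ^ 2 * (1 + 1 / γ) * ((1 + c + Real.log (1 + γ)) * (k + 1) * Real.log p) :=
        mul_le_mul_of_nonneg_left hlog (by positivity)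
    _ = _ := by ring

variable {n p : ℕ} {X : Matrix (Fin n) (Fin p) ℝ}

theorem loss_eq_zero_of_rank_eq_zero (hX : X.rank = 0) (β : EuclideanSpace ℝ (Fin p))
    (M : Finset (Fin p)) (y : EuclideanSpace ℝ (Fin n)) : loss X β M y = 0 := by
  have hbot : colSpan X Finset.univ = ⊥ := by
    rw [← Submodule.finrank_eq_zero (R := ℝ), finrank_colSpan_univ, hX]
  have hz : ∀ v, X.toEuclideanLin v = 0 := fun v => by
    have := toEuclideanLin_mem_colSpan_univ X v
    rwa [hbot, Submodule.mem_bot] at this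
  simp [loss, hz]

theorem exists_card_le_rank_colSpan_eq (hX : ColumnsInGeneralPosition X) (M : Finset (Fin p)) :
    ∃ M' : Finset (Fin p), M'.card ≤ X.rank ∧ colSpan X M' = colSpan X M := by
  rcases le_total M.card X.rank with h | h
  · exact ⟨M, h, rfl⟩
  · obtain ⟨M', -, hM'⟩ := Finset.exists_subset_card_eq h
    exact ⟨M', hM'.le, by rw [colSpan_eq_univ hX h, colSpan_eq_univ hX hM'.ge]⟩

/-- If `p = r = 1`, the lower bound forces `π 0 ≥ 1`, leaving no mass for `π 1 > 0`. Hence `log p`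
is bounded away from zero. -/
theorem two_le_of_rank_pos {c : ℝ} {π : ℕ → ℝ} (hX : 0 < X.rank)
    (hπ : IsSizePrior X.rank π) (h0 : (p : ℝ) ^ (-c) ≤ π 0) : 2 ≤ p := by
  by_contra! hp
  have hr : X.rank ≤ p := X.rank_le_width
  have hr1 : X.rank = 1 := by omega
  have hp1 : p = 1 := by omega
  have hsum := hπ.sum_eq_one
  have hpos := hπ.pos 1 hr1.ge
  rw [hr1, Finset.sum_range_succ, Finset.sum_range_one] at hsum
  rw [hp1, Nat.cast_one, Real.one_rpow] at h0
  linarith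

end LogPenalty

/-- The constant of the logarithmic oracle inequality. -/
noncomputable def oracleConst (γ c : ℝ) : ℝ :=
  (2 + 2 * (1 + 1 / γ) * (1 + c + Real.log (1 + γ)) +
    4 * (1 + 1 / γ) * Real.exp ((Real.log (1 + γ) + 1) / 2)) * (4 * γ + 6)

theorem one_le_oracleConst {γ c : ℝ} (hγ : 0 < γ) (hc : 0 < c) : 1 ≤ oracleConst γ c := by
  have hlg : 0 ≤ Real.log (1 + γ) := Real.log_nonneg (by linarith)
  have h1 : 0 ≤ 2 * (1 + 1 / γ) * (1 + c + Real.log (1 + γ)) := by positivity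
  have h2 : 0 ≤ 4 * (1 + 1 / γ) * Real.exp ((Real.log (1 + γ) + 1) / 2) := by positivity
  rw [oracleConst]
  nlinarith

end MAPSelection

open MAPSelection in
theorem theorem2 :
    ∀ γ : ℝ, 0 < γ → ∀ c : ℝ, 0 < c →
      ∃ c₂ : ℝ, 1 ≤ c₂ ∧
        ∀ (n p : ℕ) (X : Matrix (Fin n) (Fin p) ℝ) (σ : ℝ) (π : ℕ → ℝ)
          (β : EuclideanSpace ℝ (Fin p)),
          MAPSelection.ColumnsInGeneralPosition X →
          0 < σ →
          MAPSelection.IsSizePrior X.rank π →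
          MAPSelection.AssumptionP p X.rank γ π →
          (p : ℝ) ^ (-c) ≤ π 0 →
          (∀ k : ℕ, 1 ≤ k → k ≤ X.rank → (p : ℝ) ^ (-(c * k)) ≤ π k) →
          ∀ {Ω : Type*} [MeasurableSpace Ω] (P : Measure Ω) [IsProbabilityMeasure P]
            (ε y : Ω → EuclideanSpace ℝ (Fin n)) (Mhat : Ω → Finset (Fin p)),
            HasLaw ε (multivariateGaussian 0 (σ ^ 2 • (1 : Matrix (Fin n) (Fin n) ℝ))) P →
            (∀ ω, y ω = X.toEuclideanLin β + ε ω) →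
            AEMeasurable Mhat P →
            (∀ᵐ ω ∂P, MAPSelection.IsMAPModel X σ γ π (y ω) (Mhat ω)) →
            Integrable (fun ω => MAPSelection.loss X β (Mhat ω) (y ω)) P ∧
            ∫ ω, MAPSelection.loss X β (Mhat ω) (y ω) ∂P ≤
              c₂ * Real.log p *
                ((⨅ M : Finset (Fin p), ∫ ω, MAPSelection.loss X β M (y ω) ∂P) + σ ^ 2) := by
  intro γ hγ c hc
  refine ⟨oracleConst γ c, one_le_oracleConst hγ hc, ?_⟩
  intro n p X σ π β hX hσ hπ hP h0 h1 Ω _ P _ ε y Mhat hε hy hM hMAP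
  have h := hasLaw_inv_smul_stdGaussian hσ hε
  refine ⟨integrable_loss_selected hσ h hy hM, ?_⟩
  have hc₂ := one_le_oracleConst hγ hc
  -- At rank zero `log p` may vanish, but so does every loss.
  rcases Nat.eq_zero_or_pos X.rank with hr0 | hrpos
  · simp only [loss_eq_zero_of_rank_eq_zero hr0, integral_zero, ciInf_const, zero_add]
    have := Real.log_natCast_nonneg p
    positivity
  have hp := two_le_of_rank_pos hrpos hπ h0
  have hlog := one_le_two_mul_log hp
  have hC : 0 < oracleConst γ c * Real.log p := mul_pos (by linarith) (by linarith)
  suffices hbound : ∀ M : Finset (Fin p), ∫ ω, loss X β (Mhat ω) (y ω) ∂P ≤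
      oracleConst γ c * Real.log p * (∫ ω, loss X β M (y ω) ∂P + σ ^ 2) by
    rw [← div_le_iff₀' hC, ← sub_le_iff_le_add]
    refine le_ciInf fun M => ?_
    rw [sub_le_iff_le_add, div_le_iff₀' hC]
    exact hbound M
  intro M
  -- Models larger than `r` do not compete for the criterion, but each has the same column space,
  -- hence the same risk, as one of size `r`.
  obtain ⟨M', hM', hspan⟩ := exists_card_le_rank_colSpan_eq hX M
  rw [integral_loss hσ h hy M, ← hspan, finrank_colSpan hX hM']
  -- This choice meets `4ηγ ≤ 1` and makes the absorbed fraction leave `1 - a = 1 / (4γ + 6)`, the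
  -- source of that factor in `oracleConst`.
  obtain ⟨η, hη⟩ : ∃ η, η = 1 / (4 * (γ + 1)) := ⟨_, rfl⟩
  have hη0 : 0 < η := by rw [hη]; positivity
  have hηγ : 4 * η * γ ≤ 1 := by
    rw [hη, show 4 * (1 / (4 * (γ + 1))) * γ = γ / (γ + 1) by field_simp,
      div_le_one (by linarith)]
    linarith
  have hor := integral_loss_map_le hγ hη0 hηγ hσ hX h hy hπ hP hM hMAP hM'
  have hpen := penalty_le_log (σ := σ) hγ hc.le hp X.rank_le_width hπ h0 h1 hM'
  have hfac : η / (1 + 2 * η) = (4 * γ + 6)⁻¹ := by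
    rw [hη]
    field_simp
    ring
  rw [hfac, inv_mul_le_iff₀ (by linarith)] at hor
  refine hor.trans ?_
  obtain ⟨B, hB⟩ : ∃ B, B = ‖(colSpan X M').starProjection (X.toEuclideanLin β) -
    X.toEuclideanLin β‖ ^ 2 := ⟨_, rfl⟩
  have hB0 : 0 ≤ B := by rw [hB]; positivity
  obtain ⟨K, hK⟩ : ∃ K, K = Real.exp ((Real.log (1 + γ) + 1) / 2) := ⟨_, rfl⟩
  have hK0 : 0 ≤ K := by rw [hK]; positivity
  obtain ⟨A, hA⟩ : ∃ A, A = 2 * (1 + 1 / γ) * (1 + c + Real.log (1 + γ)) := ⟨_, rfl⟩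
  have hlg : 0 ≤ Real.log (1 + γ) := Real.log_nonneg (by linarith)
  have hA0 : 0 ≤ A := by rw [hA]; positivity
  rw [oracleConst, ← hB, ← hK, ← hA]
  rw [← hA] at hpen
  have hnoise : 2 * σ ^ 2 * (1 + 1 / γ) / (1 + η) * K ≤
      4 * (1 + 1 / γ) * K * σ ^ 2 * Real.log p := by
    have e1 : 2 * σ ^ 2 * (1 + 1 / γ) / (1 + η) ≤ 2 * σ ^ 2 * (1 + 1 / γ) :=
      div_le_self (by positivity) (by linarith)
    have e2 := mul_le_mul_of_nonneg_right e1 hK0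
    have e3 : 2 * σ ^ 2 * (1 + 1 / γ) * K * 1 ≤
      2 * σ ^ 2 * (1 + 1 / γ) * K * (2 * Real.log p) :=
      mul_le_mul_of_nonneg_left hlog (by positivity)
    linarith
  have hlp : 0 ≤ Real.log p := by linarith
  -- Since `2 log p ≥ 1`, terms without a logarithm are absorbed at the cost of a factor 2.
  have hbias : B ≤ 2 * B * Real.log p := by nlinarith
  obtain ⟨N, hN⟩ : ∃ N, N = 4 * (1 + 1 / γ) * K := ⟨_, rfl⟩
  have hN0 : 0 ≤ N := by rw [hN]; positivity
  obtain ⟨S, hS⟩ : ∃ S, S = σ ^ 2 * (M'.card : ℝ) := ⟨_, rfl⟩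
  have hS0 : 0 ≤ S := by rw [hS]; positivity
  rw [← hN] at hnoise ⊢
  have hS1 : σ ^ 2 * ((M'.card : ℝ) + 1) = S + σ ^ 2 := by rw [hS]; ring
  rw [hS1] at hpen
  rw [← hS]
  have hkey : 2 * B + A * (S + σ ^ 2) + N * σ ^ 2 ≤ (2 + A + N) * (B + S + σ ^ 2) := by
    have := sq_nonneg σ
    nlinarith [mul_nonneg hA0 hB0, mul_nonneg hN0 hB0, mul_nonneg hN0 hS0]
  have hkey' := mul_le_mul_of_nonneg_right hkey hlp
  calc (4 * γ + 6) * (B + penalty p X.rank σ γ π M'.card +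
        2 * σ ^ 2 * (1 + 1 / γ) / (1 + η) * K)
      ≤ (4 * γ + 6) * ((2 + A + N) * (B + S + σ ^ 2) * Real.log p) := by
        refine mul_le_mul_of_nonneg_left ?_ (by linarith)
        linarith
    _ = _ := by ring
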